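/- For a metric space $(X,d)$, a real number $1\le p<\infty$ and a map $\xi\colon X\to\ell^p(X)$, $x\mapsto\xi_x$, put $$S(\xi)=\sup\{d(x,y) : \xi_x(y)\neq 0\},\qquad \varepsilon(\xi;p)=\sup\Big\{\frac{\|\xi_x-\xi_y\|_p}{d(x,y)} : x\neq y\Big\},$$ and let $\epsilon_{X;p}(S)=\inf\{\varepsilon(\xi;p) : \xi\colon X\to\ell^p(X),\ \|\xi_x\|_p=1 \text{ for all } x,\ S(\xi)\le S\}$. For non-negative functions $f,g$ of a positive real variable write $f\preceq g$ if there are constants $C,D>0$ with $g(t)\ge C\,f(Dt)$ for all sufficiently large $t$. Let $\mathbb Z\wr\mathbb Z=\big(\bigoplus_{\mathbb Z}\mathbb Z\big)\rtimes\mathbb Z$ be the restricted wreath product, where $\mathbb Z$ acts by permuting (shifting) the summands, equipped with the left-invariant word metric of a finite generating set. Then for every $1\le p<\infty$ $$\epsilon_{\mathbb Z\wr\mathbb Z;p}(S)\ \preceq\ \frac{\log S}{S^{1/3}}.$$ -/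

import Mathlib

open scoped ENNReal

noncomputable section

/-! ### Asymptotic comparison of functions -/

/-- `AsympLE f g` is the relation `f ⪯ g` (equivalently `g ⪰ f`): there are positive constants
`C`, `D` with `g t ≥ C * f (D * t)` for all sufficiently large `t`. -/
def AsympLE (f g : ℝ → ℝ≥0∞) : Prop :=
  ∃ C D : ℝ, 0 < C ∧ 0 < D ∧
    ∀ᶠ t : ℝ in Filter.atTop, ENNReal.ofReal C * f (D * t) ≤ g t

/-! ### The profile of Property A -/

section Profile

variable {X : Type*} [MetricSpace X] {p : ℝ≥0∞}

/-- The propagation `S(ξ) = sup {d(x, y) : ξ_x(y) ≠ 0}` of a kernel `ξ : X → ℓ^p(X)`. -/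
def kernelPropagation (ξ : X → lp (fun _ : X => ℝ) p) : ℝ≥0∞ :=
  ⨆ (x : X) (y : X) (_ : ξ x y ≠ 0), ENNReal.ofReal (dist x y)

/-- `ε(ξ; p) = sup {‖ξ_x - ξ_y‖_p / d(x, y) : x ≠ y}`, the best Lipschitz constant of
`ξ : X → ℓ^p(X)` (equal to `∞` if `ξ` is not Lipschitz). -/
def kernelLipConst (ξ : X → lp (fun _ : X => ℝ) p) : ℝ≥0∞ :=
  ⨆ (x : X) (y : X) (_ : x ≠ y), ENNReal.ofReal (‖ξ x - ξ y‖ / dist x y)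

variable (X p) in
/-- The profile `ε_{X;p}(S)`: the infimum of `ε(ξ; p)` over all maps `ξ` from `X` to the unit
sphere of (real) `ℓ^p(X)` with `S(ξ) ≤ S`. -/
def propAProfile (S : ℝ) : ℝ≥0∞ :=
  ⨅ (ξ : X → lp (fun _ : X => ℝ) p) (_ : ∀ x, ‖ξ x‖ = 1)
    (_ : kernelPropagation ξ ≤ ENNReal.ofReal S), kernelLipConst ξ

end Profile

/-! ### Word metrics -/

section WordMetric

variable {G : Type*} [Group G]

/-- The lengths of the words in the letters `T ∪ T⁻¹` that represent `g`. -/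
def wordLengths (T : Set G) (g : G) : Set ℕ :=
  {n | ∃ l : List G, (∀ s ∈ l, s ∈ T ∨ s⁻¹ ∈ T) ∧ l.prod = g ∧ l.length = n}

/-- The word length of `g` with respect to `T`. -/
def wordLength (T : Set G) (g : G) : ℕ := sInf (wordLengths T g)

theorem wordLengths_nonempty {T : Set G} (hT : Subgroup.closure T = ⊤) (g : G) :
    (wordLengths T g).Nonempty := by
  have hg : g ∈ (Subgroup.closure T).toSubmonoid := hT ▸ Subgroup.mem_top g
  rw [Subgroup.closure_toSubmonoid] at hg
  obtain ⟨l, hl, rfl⟩ := Submonoid.exists_list_of_mem_closure hg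
  exact ⟨l.length, l, fun s hs => by simpa using hl s hs, rfl, rfl⟩

theorem wordLength_le {T : Set G} (l : List G) (hl : ∀ s ∈ l, s ∈ T ∨ s⁻¹ ∈ T) :
    wordLength T l.prod ≤ l.length :=
  Nat.sInf_le ⟨l, hl, rfl, rfl⟩

theorem exists_word {T : Set G} (hT : Subgroup.closure T = ⊤) (g : G) :
    ∃ l : List G, (∀ s ∈ l, s ∈ T ∨ s⁻¹ ∈ T) ∧ l.prod = g ∧ l.length = wordLength T g :=
  Nat.sInf_mem (wordLengths_nonempty hT g)

theorem wordLength_one (T : Set G) : wordLength T (1 : G) = 0 := by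
  simpa using wordLength_le (T := T) [] (by simp)

theorem wordLength_inv_le {T : Set G} (hT : Subgroup.closure T = ⊤) (g : G) :
    wordLength T g⁻¹ ≤ wordLength T g := by
  obtain ⟨l, hl, rfl, hn⟩ := exists_word hT g
  rw [← hn, List.prod_inv_reverse]
  refine (wordLength_le _ ?_).trans (by simp)
  intro s hs
  simp only [List.mem_reverse, List.mem_map] at hs
  obtain ⟨a, ha, rfl⟩ := hs
  simpa [or_comm] using hl a ha

theorem wordLength_mul_le {T : Set G} (hT : Subgroup.closure T = ⊤) (g h : G) :
    wordLength T (g * h) ≤ wordLength T g + wordLength T h := by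
  obtain ⟨l, hl, rfl, hn⟩ := exists_word hT g
  obtain ⟨k, hk, rfl, hm⟩ := exists_word hT h
  rw [← hn, ← hm, ← List.prod_append, ← List.length_append]
  refine wordLength_le _ ?_
  intro s hs
  rcases List.mem_append.1 hs with h | h
  exacts [hl s h, hk s h]

/-- The left-invariant word metric `d(x, y) = |x⁻¹ y|_T` on a group with generating set `T`. -/
abbrev wordMetricSpace (T : Set G) (hT : Subgroup.closure T = ⊤) : MetricSpace G where
  dist x y := (wordLength T (x⁻¹ * y) : ℝ)
  dist_self x := by simp [wordLength_one]
  dist_comm x y := by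
    have h : ∀ a b : G, wordLength T (a⁻¹ * b) ≤ wordLength T (b⁻¹ * a) := fun a b => by
      simpa using wordLength_inv_le hT (b⁻¹ * a)
    exact_mod_cast le_antisymm (h x y) (h y x)
  dist_triangle x y z := by
    have h := wordLength_mul_le hT (x⁻¹ * y) (y⁻¹ * z)
    have e : x⁻¹ * y * (y⁻¹ * z) = x⁻¹ * z := by group
    rw [e] at h
    exact_mod_cast h
  eq_of_dist_eq_zero {x y} h := by
    have h0 : wordLength T (x⁻¹ * y) = 0 := by exact_mod_cast h
    obtain ⟨l, -, hp, hn⟩ := exists_word hT (x⁻¹ * y)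
    rw [h0, List.length_eq_zero_iff] at hn
    subst hn
    exact inv_mul_eq_one.1 hp.symm

/-- The profile `ε_{G;p}` of a group `G` with the word metric of a generating set `T`. -/
def wordPropAProfile (T : Set G) (hT : Subgroup.closure T = ⊤) (p : ℝ≥0∞) : ℝ → ℝ≥0∞ :=
  letI := wordMetricSpace T hT
  propAProfile G p

end WordMetric

/-! ### Restricted wreath products -/

/-- The action of `G` on `⨁_G A` permuting the factors: `(g • f)(x) = f(g⁻¹ x)`. -/
def wreathShift (A G : Type*) [AddCommGroup A] [Group G] :
    G →* MulAut (Multiplicative (G →₀ A)) where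
  toFun g := AddEquiv.toMultiplicative (Finsupp.domCongr (Equiv.mulLeft g))
  map_one' := by
    ext f x
    change f.toAdd ((1 : G)⁻¹ * x) = f.toAdd x
    simp
  map_mul' g h := by
    ext f x
    change f.toAdd ((g * h)⁻¹ * x) = f.toAdd (h⁻¹ * (g⁻¹ * x))
    simp [mul_assoc]

/-- The restricted wreath product `A ≀ G = (⨁_G A) ⋊ G`, for an abelian group `A` written
additively. -/
abbrev RestrictedWreath (A G : Type*) [AddCommGroup A] [Group G] : Type _ :=
  Multiplicative (G →₀ A) ⋊[wreathShift A G] G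

/-- The group `ℤ ≀ ℤ`. -/
abbrev ZWrZ : Type := RestrictedWreath ℤ (Multiplicative ℤ)

end

/-!
The group `ℤ ≀ ℤ` is amenable, and averaging kernels can be taken left-invariant. If `F` is a
finitely supported function on a group `G`, the kernel `ξ_x(y) = F(y⁻¹ x)` (`translateKernel`) has
constant norm `‖F‖`, its propagation is the largest word length on the support of `F`, and its
Lipschitz constant is controlled by the differences between `F` and its right translates by the
generators.

On `ℤ ≀ ℤ`, take for `F` the function `bump m`, which at `(v, k)` is a product of tent functions of
width comparable to `m`: one in `k` and one in each coordinate `v i` with `|i| ≤ 2 m`, the other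
coordinates being required to vanish. Right multiplication by a standard generator moves just one
of these coordinates by one unit. For the tent function `φ` of half-width `2 m`, the difference
`|φ(j) - φ(j + 1)|` is at most `(φ(j + m) + φ(j - m)) / m` (`tent_sub_le`). Hence the difference
between `F` and its translate by a generator `s` is bounded pointwise by `1 / m` times the sum of
the translates of `F` by `s ^ m` and `s ^ (-m)`, and since all translates have the same `ℓ^p` norm,
`‖ξ_x - ξ_{x s}‖ ≤ (2 / m) ‖F‖`. This works for all `p < ∞` at once, with no computation of norms.

The support of `bump m` involves `O(m)` lamps with values and positions of size `O(m)`, so it lies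
in a ball of radius `O(m²)`. The profile is therefore `O(S ^ (-1/2))`, which is better than
`log S / S ^ (1/3)`. Passing from the standard generators to another finite generating set only
changes the constants (`exists_displacement_bound_of_finite`).
-/

open Multiplicative

/-! ### Translates of a finitely supported function in `ℓ^p` -/

theorem lp_norm_le_of_abs_le {ι : Type*} {p : ℝ≥0∞} (hp1 : 1 ≤ p) (hp : p ≠ ∞)
    {u v : lp (fun _ : ι => ℝ) p} (h : ∀ y, |u y| ≤ v y) : ‖u‖ ≤ ‖v‖ := by
  have : Fact (1 ≤ p) := ⟨hp1⟩
  have h0 : 0 < p.toReal := ENNReal.toReal_pos (one_pos.trans_le hp1).ne' hp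
  refine lp.norm_le_of_tsum_le h0 (norm_nonneg v) ?_
  rw [lp.norm_rpow_eq_tsum h0]
  refine Summable.tsum_le_tsum (fun y => ?_) ((lp.memℓp u).summable h0) ((lp.memℓp v).summable h0)
  exact Real.rpow_le_rpow (norm_nonneg _) ((h y).trans (le_abs_self _)) h0.le

section Translates

variable {G : Type*} [Group G] {p : ℝ≥0∞}

/-- The kernel `x ↦ (y ↦ F (y⁻¹ x))` on a group defined by a finitely supported function `F`. It
commutes with left translations, so its Lipschitz constant only depends on how `F` behaves under
right translations by generators. -/
noncomputable def translateKernel (p : ℝ≥0∞) (F : G →₀ ℝ) (x : G) : lp (fun _ : G => ℝ) p :=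
  ⟨fun y => F (y⁻¹ * x), (memℓp_zero (by
    refine (F.hasFiniteSupport.image fun g => x * g⁻¹).subset fun y hy => ⟨y⁻¹ * x, ?_, by simp⟩
    simpa using hy)).of_exponent_ge zero_le⟩

theorem translateKernel_apply (F : G →₀ ℝ) (x y : G) :
    translateKernel p F x y = F (y⁻¹ * x) := rfl

theorem norm_translateKernel (hp1 : 1 ≤ p) (hp : p ≠ ∞) (F : G →₀ ℝ) (x : G) :
    ‖translateKernel p F x‖ = ‖translateKernel p F 1‖ := by
  have h0 : 0 < p.toReal := ENNReal.toReal_pos (one_pos.trans_le hp1).ne' hp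
  rw [lp.norm_eq_tsum_rpow h0, lp.norm_eq_tsum_rpow h0]
  congr 1
  rw [← (Equiv.mulLeft x).tsum_eq]
  simp [translateKernel_apply]

/-- A pointwise bound for `F (g) - F (g s)` by two other translates of `F` becomes a norm bound,
because all translates of `F` have the same norm. -/
theorem norm_translateKernel_sub_le (hp1 : 1 ≤ p) (hp : p ≠ ∞) (F : G →₀ ℝ) {s u v : G} {m : ℝ}
    (hm : 0 < m) (h : ∀ g, m * |F g - F (g * s)| ≤ F (g * u) + F (g * v)) (x : G) :
    ‖translateKernel p F x - translateKernel p F (x * s)‖ ≤ 2 / m * ‖translateKernel p F 1‖ := by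
  have : Fact (1 ≤ p) := ⟨hp1⟩
  have key : ‖m • (translateKernel p F x - translateKernel p F (x * s))‖ ≤
      ‖translateKernel p F (x * u) + translateKernel p F (x * v)‖ := by
    refine lp_norm_le_of_abs_le hp1 hp fun y => ?_
    have := h (y⁻¹ * x)
    rw [lp.coeFn_smul, Pi.smul_apply, lp.coeFn_sub, Pi.sub_apply, lp.coeFn_add, Pi.add_apply,
      smul_eq_mul, abs_mul, abs_of_pos hm]
    simpa [translateKernel_apply, mul_assoc] using this
  rw [norm_smul, Real.norm_of_nonneg hm.le] at key
  have h2 := key.trans (norm_add_le _ _)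
  rw [norm_translateKernel hp1 hp F (x * u), norm_translateKernel hp1 hp F (x * v)] at h2
  rw [div_mul_eq_mul_div, le_div_iff₀ hm]
  linarith

end Translates

/-! ### Word length and Lipschitz maps -/

section WordLength

variable {G : Type*} [Group G]

theorem wordLength_pow_le {T : Set G} (hT : Subgroup.closure T = ⊤) (g : G) (n : ℕ) :
    wordLength T (g ^ n) ≤ n * wordLength T g := by
  induction n with
  | zero => simp [wordLength_one]
  | succ n ih =>
    rw [pow_succ, add_mul, one_mul]
    exact (wordLength_mul_le hT _ _).trans (by gcongr)

theorem wordLength_zpow_le {T : Set G} (hT : Subgroup.closure T = ⊤) (g : G) (n : ℤ) :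
    wordLength T (g ^ n) ≤ n.natAbs * wordLength T g := by
  obtain ⟨n, rfl | rfl⟩ := n.eq_nat_or_neg
  · simpa using wordLength_pow_le hT g n
  · simpa using (wordLength_inv_le hT _).trans (wordLength_pow_le hT g n)

/-- Control of the displacement under right multiplication by the elements of `A` gives control
of the displacement under right multiplication by any `g` in the subgroup generated by `A`, with
a factor `K` that does not depend on the map. -/
theorem exists_displacement_bound {E : Type*} [SeminormedAddCommGroup E] (A : Set G) {g : G}
    (hg : g ∈ Subgroup.closure A) :
    ∃ K : ℝ, 0 ≤ K ∧ ∀ (f : G → E) (L : ℝ), 0 ≤ L → (∀ s ∈ A, ∀ x, ‖f x - f (x * s)‖ ≤ L) →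
      ∀ x, ‖f x - f (x * g)‖ ≤ K * L := by
  induction hg using Subgroup.closure_induction with
  | mem s hs => exact ⟨1, zero_le_one, fun f L _ h x => by simpa using h s hs x⟩
  | one => exact ⟨0, le_rfl, fun f L _ h x => by simp⟩
  | mul a b _ _ ha hb =>
    obtain ⟨K, hK, hKa⟩ := ha
    obtain ⟨K', hK', hKb⟩ := hb
    refine ⟨K + K', add_nonneg hK hK', fun f L hL h x => ?_⟩
    have h1 := hKa f L hL h x
    have h2 := hKb f L hL h (x * a)
    rw [mul_assoc] at h2
    linarith [norm_sub_le_norm_sub_add_norm_sub (f x) (f (x * a)) (f (x * (a * b)))]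
  | inv a _ ha =>
    obtain ⟨K, hK, hKa⟩ := ha
    refine ⟨K, hK, fun f L hL h x => ?_⟩
    have h1 := hKa f L hL h (x * a⁻¹)
    rwa [inv_mul_cancel_right, norm_sub_rev] at h1

theorem exists_displacement_bound_of_finite (E : Type*) [SeminormedAddCommGroup E] (A : Set G)
    (hA : Subgroup.closure A = ⊤) {T : Set G} (hfin : T.Finite) :
    ∃ K : ℝ, 0 ≤ K ∧ ∀ (f : G → E) (L : ℝ), 0 ≤ L → (∀ s ∈ A, ∀ x, ‖f x - f (x * s)‖ ≤ L) →
      ∀ s ∈ T, ∀ x, ‖f x - f (x * s)‖ ≤ K * L := by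
  choose K hK hf using fun g : G => exists_displacement_bound (E := E) A (hA ▸ Subgroup.mem_top g)
  refine ⟨∑ s ∈ hfin.toFinset, K s, Finset.sum_nonneg fun s _ => hK s, fun f L hL h s hs x => ?_⟩
  refine (hf s f L hL h x).trans (mul_le_mul_of_nonneg_right ?_ hL)
  exact Finset.single_le_sum (fun s _ => hK s) (hfin.mem_toFinset.2 hs)

theorem norm_sub_le_wordLength_mul {E : Type*} [SeminormedAddCommGroup E] {T : Set G}
    (hT : Subgroup.closure T = ⊤) {f : G → E} {L : ℝ}
    (h : ∀ s ∈ T, ∀ x, ‖f x - f (x * s)‖ ≤ L) (x y : G) :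
    ‖f x - f y‖ ≤ wordLength T (x⁻¹ * y) * L := by
  have key : ∀ l : List G, (∀ s ∈ l, s ∈ T ∨ s⁻¹ ∈ T) → ∀ x,
      ‖f x - f (x * l.prod)‖ ≤ l.length * L := by
    intro l
    induction l with
    | nil => simp
    | cons s l ih =>
      intro hl x
      have h1 : ‖f x - f (x * s)‖ ≤ L := by
        rcases hl s List.mem_cons_self with hs | hs
        · exact h s hs x
        · simpa [norm_sub_rev] using h _ hs (x * s)
      have h2 := ih (fun r hr => hl r (List.mem_cons_of_mem _ hr)) (x * s)
      rw [mul_assoc] at h2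
      rw [List.prod_cons, List.length_cons, Nat.cast_succ]
      linarith [norm_sub_le_norm_sub_add_norm_sub (f x) (f (x * s)) (f (x * (s * l.prod)))]
  obtain ⟨l, hl, hp, hn⟩ := exists_word hT (x⁻¹ * y)
  simpa [hp, hn] using key l hl x

/-- A finitely supported function on `G` that is supported in the ball of radius `R` and is almost
invariant under right translations bounds the profile of `G`. -/
theorem wordPropAProfile_le {T : Set G} (hT : Subgroup.closure T = ⊤) {p : ℝ≥0∞} (hp1 : 1 ≤ p)
    (hp : p ≠ ∞) {F : G →₀ ℝ} (hF : F ≠ 0) {R L : ℝ}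
    (hR : ∀ g, F g ≠ 0 → (wordLength T g : ℝ) ≤ R)
    (hL : ∀ s ∈ T, ∀ x, ‖translateKernel p F x - translateKernel p F (x * s)‖ ≤
      L * ‖translateKernel p F 1‖) :
    wordPropAProfile T hT p R ≤ ENNReal.ofReal L := by
  let _ := wordMetricSpace T hT
  have : Fact (1 ≤ p) := ⟨hp1⟩
  have hN : 0 < ‖translateKernel p F 1‖ := by
    rw [norm_pos_iff]
    intro h0
    refine hF (Finsupp.ext fun g => ?_)
    have := congrArg (fun u : lp (fun _ : G => ℝ) p => u g⁻¹) h0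
    simpa [translateKernel_apply] using this
  set N := ‖translateKernel p F 1‖
  refine iInf_le_of_le (fun x => N⁻¹ • translateKernel p F x) ?_
  refine iInf_le_of_le (fun x => ?_) (iInf_le_of_le ?_ ?_)
  · rw [norm_smul, norm_translateKernel hp1 hp, Real.norm_of_nonneg (inv_nonneg.2 hN.le)]
    exact inv_mul_cancel₀ hN.ne'
  · refine iSup_le fun x => iSup_le fun y => iSup_le fun hxy => ENNReal.ofReal_le_ofReal ?_
    rw [dist_comm]
    refine hR _ fun h0 => hxy ?_
    simp [translateKernel_apply, h0]
  · refine iSup_le fun x => iSup_le fun y => iSup_le fun hxy => ENNReal.ofReal_le_ofReal ?_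
    rw [div_le_iff₀ (dist_pos.2 hxy), ← smul_sub, norm_smul,
      Real.norm_of_nonneg (inv_nonneg.2 hN.le), inv_mul_le_iff₀ hN]
    refine (norm_sub_le_wordLength_mul hT hL x y).trans_eq ?_
    change (wordLength T (x⁻¹ * y) : ℝ) * (L * N) = N * (L * (wordLength T (x⁻¹ * y) : ℝ))
    ring

end WordLength

/-! ### The standard generators of `ℤ ≀ ℤ` -/

namespace ZWrZ

/-- The generator of the copy of `ℤ` at position `0` of the base group `⨁_ℤ ℤ`. -/
noncomputable def lamp : ZWrZ := SemidirectProduct.inl (ofAdd (Finsupp.single 1 1))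

/-- The generator of the acting copy of `ℤ`. -/
noncomputable def step : ZWrZ := SemidirectProduct.inr (ofAdd 1)

theorem step_zpow (k : ℤ) : step ^ k = SemidirectProduct.inr (ofAdd k) := by
  rw [step, ← map_zpow, ← ofAdd_zsmul, smul_eq_mul, mul_one]

theorem lamp_zpow (c : ℤ) :
    lamp ^ c = SemidirectProduct.inl (ofAdd (Finsupp.single 1 c)) := by
  rw [lamp, ← map_zpow, ← ofAdd_zsmul, Finsupp.smul_single, smul_eq_mul, mul_one]

theorem wreathShift_single (k i : Multiplicative ℤ) (c : ℤ) :
    wreathShift ℤ (Multiplicative ℤ) k (ofAdd (Finsupp.single i c)) =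
      ofAdd (Finsupp.single (k * i) c) := by
  change ofAdd (Finsupp.domCongr (Equiv.mulLeft k) (Finsupp.single i c)) = _
  simp [Finsupp.domCongr_apply]

theorem inl_single (i : Multiplicative ℤ) (c : ℤ) :
    (SemidirectProduct.inl (ofAdd (Finsupp.single i c)) : ZWrZ) =
      step ^ toAdd i * lamp ^ c * (step ^ toAdd i)⁻¹ := by
  rw [step_zpow, lamp_zpow, ofAdd_toAdd, ← map_inv, ← SemidirectProduct.inl_aut,
    wreathShift_single, mul_one]

theorem closure_lamp_step : Subgroup.closure ({lamp, step} : Set ZWrZ) = ⊤ := by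
  refine eq_top_iff.2 fun g _ => ?_
  have hl : lamp ∈ Subgroup.closure ({lamp, step} : Set ZWrZ) := Subgroup.subset_closure (by simp)
  have hs : step ∈ Subgroup.closure ({lamp, step} : Set ZWrZ) := Subgroup.subset_closure (by simp)
  have hleft : ∀ v : Multiplicative ℤ →₀ ℤ, (SemidirectProduct.inl (ofAdd v) : ZWrZ) ∈
      Subgroup.closure ({lamp, step} : Set ZWrZ) := by
    intro v
    induction v using Finsupp.induction_linear with
    | zero => simp
    | add v w hv hw =>
      rw [ofAdd_add, map_mul]
      exact mul_mem hv hw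
    | single i c =>
      rw [inl_single]
      exact mul_mem (mul_mem (zpow_mem hs _) (zpow_mem hl _)) (inv_mem (zpow_mem hs _))
  rw [← SemidirectProduct.inl_left_mul_inr_right g]
  refine mul_mem (hleft (toAdd g.left)) ?_
  have := zpow_mem hs (toAdd g.right)
  rwa [step_zpow] at this

theorem mul_step_zpow (g : ZWrZ) (c : ℤ) : g * step ^ c = ⟨g.left, g.right * ofAdd c⟩ := by
  rw [step_zpow]
  ext1 <;> simp

theorem mul_lamp_zpow (g : ZWrZ) (c : ℤ) :
    g * lamp ^ c = ⟨ofAdd (toAdd g.left + Finsupp.single g.right c), g.right⟩ := by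
  rw [lamp_zpow]
  ext1
  · rw [SemidirectProduct.mul_left, SemidirectProduct.left_inl, wreathShift_single, mul_one]
    rfl
  · simp

theorem wordLength_inl_single_le {T : Set ZWrZ} (hT : Subgroup.closure T = ⊤)
    (i : Multiplicative ℤ) (c : ℤ) :
    wordLength T (SemidirectProduct.inl (ofAdd (Finsupp.single i c)) : ZWrZ) ≤
      2 * (toAdd i).natAbs * wordLength T step + c.natAbs * wordLength T lamp := by
  rw [inl_single]
  have h1 := wordLength_mul_le hT (step ^ toAdd i * lamp ^ c) (step ^ toAdd i)⁻¹
  have h2 := wordLength_mul_le hT (step ^ toAdd i) (lamp ^ c)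
  have h3 := wordLength_inv_le hT (step ^ toAdd i)
  have h4 := wordLength_zpow_le hT step (toAdd i)
  have h5 := wordLength_zpow_le hT lamp c
  linarith

theorem wordLength_inl_sum_le {T : Set ZWrZ} (hT : Subgroup.closure T = ⊤) {ι : Type*}
    (I : Finset ι) (f : ι → Multiplicative ℤ →₀ ℤ) :
    wordLength T (SemidirectProduct.inl (ofAdd (∑ i ∈ I, f i)) : ZWrZ) ≤
      ∑ i ∈ I, wordLength T (SemidirectProduct.inl (ofAdd (f i)) : ZWrZ) := by
  classical
  induction I using Finset.induction_on with
  | empty => simp [wordLength_one]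
  | insert i I hi ih =>
    rw [Finset.sum_insert hi, Finset.sum_insert hi, ofAdd_add, map_mul]
    exact (wordLength_mul_le hT _ _).trans (by gcongr)

/-! ### The almost invariant functions -/

/-- The tent function of height and half-width `2 m` on `ℤ`. -/
noncomputable def tent (m : ℕ) (j : ℤ) : ℝ := (max 0 (2 * m - |j|) : ℤ)

theorem tent_nonneg (m : ℕ) (j : ℤ) : 0 ≤ tent m j := by
  unfold tent
  exact_mod_cast le_max_left _ _

theorem tent_eq_zero {m : ℕ} {j : ℤ} (h : 2 * (m : ℤ) ≤ |j|) : tent m j = 0 := by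
  unfold tent
  exact_mod_cast max_eq_left (by omega)

/-- The tent function varies by at most `1` at the points where it varies at all, and each of
these points is within `m` of a point where its value is at least `m`. -/
theorem tent_sub_le (m : ℕ) (j : ℤ) :
    m * |tent m j - tent m (j + 1)| ≤ tent m (j + m) + tent m (j + -m) := by
  unfold tent
  norm_cast
  push_cast
  have h0 : |max 0 (2 * (m : ℤ) - |j|) - max 0 (2 * (m : ℤ) - |j + 1|)| ≤ 1 := by
    grind
  by_cases hj : -2 * (m : ℤ) ≤ j ∧ j < 2 * m
  · have : (m : ℤ) * |max 0 (2 * (m : ℤ) - |j|) - max 0 (2 * (m : ℤ) - |j + 1|)| ≤ m * 1 := by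
      gcongr
    grind
  · have : |max 0 (2 * (m : ℤ) - |j|) - max 0 (2 * (m : ℤ) - |j + 1|)| = 0 := by
      grind
    rw [this]
    grind

/-- The positions `-2 m, …, 2 m`, outside of which the base-group component vanishes on the
support of `bump m`. -/
noncomputable def window (m : ℕ) : Finset (Multiplicative ℤ) :=
  (Finset.Icc (-(2 * m) : ℤ) (2 * m)).map ofAdd.toEmbedding

theorem mem_window {m : ℕ} {i : Multiplicative ℤ} : i ∈ window m ↔ |toAdd i| ≤ 2 * m := by
  simp [window, abs_le]

open Classical in
/-- The function underlying `bump`: for `g = (v, k)` with `v` supported in `window m` it is the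
product of the tents at `k` and at all `v i` with `i` in the window; otherwise it is `0`. -/
noncomputable def bumpFun (m : ℕ) (g : ZWrZ) : ℝ :=
  if ∀ i ∉ window m, toAdd g.left i = 0 then
    tent m (toAdd g.right) * ∏ i ∈ window m, tent m (toAdd g.left i)
  else 0

theorem bumpFun_ne_zero {m : ℕ} {g : ZWrZ} (h : bumpFun m g ≠ 0) :
    |toAdd g.right| ≤ 2 * m ∧ (∀ i ∉ window m, toAdd g.left i = 0) ∧
      ∀ i, |toAdd g.left i| ≤ 2 * m := by
  unfold bumpFun at h
  split_ifs at h with h1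
  · refine ⟨?_, h1, fun i => ?_⟩
    · contrapose! h
      rw [tent_eq_zero h.le, zero_mul]
    · by_cases hi : i ∈ window m
      · contrapose! h
        exact mul_eq_zero_of_right _ (Finset.prod_eq_zero hi (tent_eq_zero h.le))
      · simp [h1 i hi]
  · exact absurd rfl h

/-- The almost invariant function on `ℤ ≀ ℤ`: a product of tent functions of half-width `2 m`,
one in the coordinate of the acting group and one in each of the coordinates of the base group at
the positions in `window m`. -/
noncomputable def bump (m : ℕ) : ZWrZ →₀ ℝ :=
  Finsupp.ofSupportFinite (bumpFun m) <| by
    classical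
    let A := (window m).finsupp fun _ => Finset.Icc (-(2 * m) : ℤ) (2 * m)
    refine ((A ×ˢ window m).finite_toSet.image
      fun q : (Multiplicative ℤ →₀ ℤ) × Multiplicative ℤ => (⟨ofAdd q.1, q.2⟩ : ZWrZ)).subset ?_
    intro g hg
    obtain ⟨h1, h2, h3⟩ := bumpFun_ne_zero hg
    refine ⟨(toAdd g.left, g.right), ?_, rfl⟩
    rw [Finset.mem_coe, Finset.mem_product]
    refine ⟨Finset.mem_finsupp_iff.2 ⟨fun i hi => ?_, fun i _ => ?_⟩, mem_window.2 h1⟩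
    · by_contra hi'
      exact (Finsupp.mem_support_iff.1 hi) (h2 i hi')
    · exact Finset.mem_Icc.2 (abs_le.1 (h3 i))

theorem bump_apply (m : ℕ) (g : ZWrZ) : bump m g = bumpFun m g := rfl

theorem bump_ne_zero {m : ℕ} (hm : 0 < m) : bump m ≠ 0 := by
  intro h
  have h1 := DFunLike.congr_fun h 1
  have h2 : tent m 0 ≠ 0 := by
    simp [tent, hm.ne']
  simp [bump_apply, bumpFun, h2] at h1

theorem bump_sub_step_le (m : ℕ) (g : ZWrZ) :
    m * |bump m g - bump m (g * step)| ≤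
      bump m (g * step ^ (m : ℤ)) + bump m (g * step ^ (-m : ℤ)) := by
  have h1 : g * step = ⟨g.left, g.right * ofAdd 1⟩ := by simpa using mul_step_zpow g 1
  simp only [bump_apply, h1, mul_step_zpow, bumpFun, toAdd_mul, toAdd_ofAdd]
  split_ifs with h
  · have hP : 0 ≤ ∏ i ∈ window m, tent m (toAdd g.left i) :=
      Finset.prod_nonneg fun i _ => tent_nonneg _ _
    rw [← sub_mul, abs_mul, abs_of_nonneg hP, ← mul_assoc, ← add_mul]
    exact mul_le_mul_of_nonneg_right (tent_sub_le m _) hP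
  · simp

/-- Right multiplication by a power of `lamp` changes a single coordinate of the base group: the
one at the position given by the acting component `k`. If `k` is in the window, the other factors
of `bump` are not affected; otherwise `bump` vanishes at all the points involved. -/
theorem exists_bump_mul_lamp_zpow (m : ℕ) (g : ZWrZ) :
    ∃ H j, 0 ≤ H ∧ ∀ c : ℤ, bump m (g * lamp ^ c) = tent m (j + c) * H := by
  classical
  by_cases hk : g.right ∈ window m
  · by_cases hv : ∀ i ∉ window m, toAdd g.left i = 0
    · refine ⟨tent m (toAdd g.right) * ∏ i ∈ (window m).erase g.right, tent m (toAdd g.left i),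
        toAdd g.left g.right, mul_nonneg (tent_nonneg _ _)
          (Finset.prod_nonneg fun i _ => tent_nonneg _ _), fun c => ?_⟩
      have hc : ∀ i ∉ window m, (toAdd g.left + Finsupp.single g.right c) i = 0 := by
        intro i hi
        have : g.right ≠ i := fun e => hi (e ▸ hk)
        simp [hv i hi, this]
      rw [bump_apply, mul_lamp_zpow, bumpFun, toAdd_ofAdd, if_pos hc,
        ← Finset.mul_prod_erase _ _ hk, Finsupp.add_apply, Finsupp.single_eq_same]
      rw [mul_left_comm]
      congr 2
      refine Finset.prod_congr rfl fun i hi => ?_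
      rw [Finsupp.add_apply, Finsupp.single_eq_of_ne (Finset.ne_of_mem_erase hi), add_zero]
    · refine ⟨0, 0, le_rfl, fun c => ?_⟩
      rw [mul_zero, bump_apply, mul_lamp_zpow, bumpFun, if_neg]
      contrapose! hv
      intro i hi
      have : g.right ≠ i := fun e => hi (e ▸ hk)
      simpa [Finsupp.single_apply, this] using hv i hi
  · refine ⟨0, 0, le_rfl, fun c => ?_⟩
    rw [mem_window, not_le] at hk
    rw [mul_zero, bump_apply, mul_lamp_zpow, bumpFun, tent_eq_zero hk.le]
    simp

theorem bump_sub_lamp_le (m : ℕ) (g : ZWrZ) :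
    m * |bump m g - bump m (g * lamp)| ≤
      bump m (g * lamp ^ (m : ℤ)) + bump m (g * lamp ^ (-m : ℤ)) := by
  obtain ⟨H, j, hH, h⟩ := exists_bump_mul_lamp_zpow m g
  have h0 := h 0
  have h1 := h 1
  rw [zpow_zero, mul_one, add_zero] at h0
  rw [zpow_one] at h1
  rw [h0, h1, h, h, ← sub_mul, abs_mul, abs_of_nonneg hH, ← mul_assoc, ← add_mul]
  exact mul_le_mul_of_nonneg_right (tent_sub_le m j) hH

theorem wordLength_le_of_bump_ne_zero {T : Set ZWrZ} (hT : Subgroup.closure T = ⊤) {m : ℕ}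
    (hm : 0 < m) {g : ZWrZ} (hg : bump m g ≠ 0) :
    wordLength T g ≤ 32 * m ^ 2 * (wordLength T step + wordLength T lamp) := by
  obtain ⟨hk, hv, hv'⟩ := bumpFun_ne_zero hg
  set K := wordLength T step + wordLength T lamp with hK
  have hsum : ∑ i ∈ window m, Finsupp.single i (toAdd g.left i) = toAdd g.left := by
    refine (Finset.sum_subset (fun i hi => ?_) fun i _ hi => ?_).symm.trans
      (Finsupp.sum_single (toAdd g.left))
    · by_contra hi'
      exact (Finsupp.mem_support_iff.1 hi) (hv i hi')
    · simpa using hi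
  have hcard : (window m).card = 4 * m + 1 := by
    rw [window, Finset.card_map, Int.card_Icc]
    omega
  have hleft : wordLength T (SemidirectProduct.inl g.left : ZWrZ) ≤ (4 * m + 1) * (4 * m * K) := by
    have h := wordLength_inl_sum_le hT (window m) fun i => Finsupp.single i (toAdd g.left i)
    rw [hsum, ofAdd_toAdd] at h
    refine h.trans ((Finset.sum_le_card_nsmul _ _ (4 * m * K) fun i hi => ?_).trans_eq ?_)
    · refine (wordLength_inl_single_le hT i _).trans ?_
      have h1 : (toAdd i).natAbs ≤ 2 * m := by
        have := mem_window.1 hi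
        rw [Int.abs_eq_natAbs] at this
        omega
      have h2 : (toAdd g.left i).natAbs ≤ 4 * m := by
        have := hv' i
        rw [Int.abs_eq_natAbs] at this
        omega
      calc _ ≤ 2 * (2 * m) * wordLength T step + 4 * m * wordLength T lamp := by gcongr
        _ = _ := by rw [hK]; ring
    · rw [hcard, smul_eq_mul]
  have hright : wordLength T (SemidirectProduct.inr g.right : ZWrZ) ≤ 2 * m * K := by
    have h := wordLength_zpow_le hT step (toAdd g.right)
    rw [step_zpow, ofAdd_toAdd] at h
    refine h.trans (Nat.mul_le_mul ?_ (Nat.le_add_right _ _))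
    rw [Int.abs_eq_natAbs] at hk
    omega
  have h := wordLength_mul_le hT (SemidirectProduct.inl g.left : ZWrZ)
    (SemidirectProduct.inr g.right)
  rw [SemidirectProduct.inl_left_mul_inr_right] at h
  have hmm : m ≤ m ^ 2 := Nat.le_self_pow two_ne_zero m
  calc wordLength T g ≤ (16 * m ^ 2 + 6 * m) * K := by linarith
    _ ≤ 32 * m ^ 2 * K := by gcongr; omega

/-! ### The bound for the profile -/

/-- At radius `D m²`, with `D` depending only on the generating set, the profile of `ℤ ≀ ℤ` is at
most a constant times `1 / m`. -/
theorem exists_wordPropAProfile_le {T : Set ZWrZ} (hfin : T.Finite) (hT : Subgroup.closure T = ⊤)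
    {p : ℝ≥0∞} (hp1 : 1 ≤ p) (hp : p ≠ ∞) :
    ∃ C D : ℝ, 0 < C ∧ 0 < D ∧ ∀ m : ℕ, 0 < m → ∀ R : ℝ, D * (m : ℝ) ^ 2 ≤ R →
      wordPropAProfile T hT p R ≤ ENNReal.ofReal (C / m) := by
  have : Fact (1 ≤ p) := ⟨hp1⟩
  obtain ⟨K, hK, hKL⟩ := exists_displacement_bound_of_finite (lp (fun _ : ZWrZ => ℝ) p)
    {lamp, step} closure_lamp_step hfin
  refine ⟨2 * K + 1, 32 * (wordLength T step + wordLength T lamp + 1 : ℕ), by positivity,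
    by positivity, fun m hm R hR => ?_⟩
  have hm' : (0 : ℝ) < m := Nat.cast_pos.2 hm
  have h := hKL (translateKernel p (bump m)) (2 / m * ‖translateKernel p (bump m) 1‖)
    (by positivity) (by
      rintro s (rfl | rfl) x
      · exact norm_translateKernel_sub_le hp1 hp _ hm' (bump_sub_lamp_le m) x
      · exact norm_translateKernel_sub_le hp1 hp _ hm' (bump_sub_step_le m) x)
  refine wordPropAProfile_le hT hp1 hp (bump_ne_zero hm) (fun g hg => ?_) fun s hs x => ?_
  · refine le_trans ?_ hR
    have hw := wordLength_le_of_bump_ne_zero hT hm hg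
    calc (wordLength T g : ℝ)
        ≤ (32 * m ^ 2 * (wordLength T step + wordLength T lamp) : ℕ) := by exact_mod_cast hw
      _ ≤ (32 * m ^ 2 * (wordLength T step + wordLength T lamp + 1) : ℕ) := by
        exact_mod_cast Nat.mul_le_mul_left _ (Nat.le_succ _)
      _ = _ := by push_cast; ring
  · refine (h s hs x).trans ?_
    rw [← mul_assoc]
    gcongr
    rw [mul_div_assoc', mul_comm K]
    gcongr
    linarith

end ZWrZ

theorem corollary4p2p7 (T : Set ZWrZ) (hfin : T.Finite) (hT : Subgroup.closure T = ⊤)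
    (p : ℝ≥0∞) (hp1 : 1 ≤ p) (hp : p ≠ ∞) :
    AsympLE (wordPropAProfile T hT p)
      (fun S : ℝ => ENNReal.ofReal (Real.log S / S ^ (1 / 3 : ℝ))) := by
  obtain ⟨C, D, hC, hD, h⟩ := ZWrZ.exists_wordPropAProfile_le hfin hT hp1 hp
  -- The witness is taken with `m = ⌈√t⌉`, so that `D m² ≤ 4 D t`.
  refine ⟨C⁻¹, 4 * D, inv_pos.2 hC, by positivity, ?_⟩
  filter_upwards [Filter.eventually_ge_atTop (Real.exp 1)] with t ht
  have ht1 : 1 ≤ t := (Real.one_le_exp zero_le_one).trans ht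
  have ht0 : 0 < t := one_pos.trans_le ht1
  have hlog : 1 ≤ Real.log t := (Real.le_log_iff_exp_le ht0).2 ht
  have hs1 : 1 ≤ √t := Real.one_le_sqrt.2 ht1
  have hm : 0 < ⌈√t⌉₊ := Nat.ceil_pos.2 (one_pos.trans_le hs1)
  have hle : √t ≤ ⌈√t⌉₊ := Nat.le_ceil _
  have hm2 : (⌈√t⌉₊ : ℝ) ≤ 2 * √t := by
    linarith [Nat.ceil_lt_add_one (Real.sqrt_nonneg t)]
  have hR : D * (⌈√t⌉₊ : ℝ) ^ 2 ≤ 4 * D * t := by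
    calc D * (⌈√t⌉₊ : ℝ) ^ 2 ≤ D * (2 * √t) ^ 2 := by gcongr
      _ = 4 * D * t := by rw [mul_pow, Real.sq_sqrt ht0.le]; ring
  calc ENNReal.ofReal C⁻¹ * wordPropAProfile T hT p (4 * D * t)
      ≤ ENNReal.ofReal C⁻¹ * ENNReal.ofReal (C / ⌈√t⌉₊) := by gcongr; exact h _ hm _ hR
    _ = ENNReal.ofReal (1 / ⌈√t⌉₊) := by
        rw [← ENNReal.ofReal_mul (inv_nonneg.2 hC.le)]
        congr 1
        field_simp
    _ ≤ ENNReal.ofReal (Real.log t / t ^ (1 / 3 : ℝ)) := by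
        refine ENNReal.ofReal_le_ofReal (div_le_div₀ (by linarith) hlog (by positivity) ?_)
        refine le_trans ?_ hle
        rw [Real.sqrt_eq_rpow]
        exact Real.rpow_le_rpow_of_exponent_le ht1 (by norm_num)
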